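/- Let $d\ge 1$ and let $M(d)$ be the space of $d\times d$ complex matrices. For $A\in M(d)$ let $\rho(A)$ be the spectral radius of $A$, i.e. the maximum absolute value of an eigenvalue of $A$. Fix any norm $\|\cdot\|$ on $\mathbb{C}^d$ and give $M(d)$ the operator norm $\|A\|=\sup\{\|Av\| : \|v\|=1\}$. For a non-empty bounded set $\Sigma\subset M(d)$ put $$\|\Sigma\|=\sup_{A\in\Sigma}\|A\|,\qquad \rho(\Sigma)=\sup_{A\in\Sigma}\rho(A),$$ and for $n\ge 1$ let $\Sigma^n$ be the set of all products $A_1\cdots A_n$ with $A_1,\dots,A_n\in\Sigma$. **Theorem (Berger–Wang).** For every non-empty bounded set $\Sigma\subset M(d)$ the limit $$\mathcal{R}(\Sigma)=\lim_{n\to\infty}\|\Sigma^n\|^{1/n}$$ (the joint spectral radius of $\Sigma$) exists and is finite, and $$\mathcal{R}(\Sigma)=\limsup_{n\to\infty}\rho(\Sigma^n)^{1/n}.$$ -/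

import Mathlib

open Filter Topology
open scoped ENNReal Pointwise Matrix

noncomputable section

/-- The operator norm `‖A‖ = sup {‖A v‖ ; ‖v‖ = 1}` of a `d × d` complex matrix with respect to
a norm `N` on `ℂ^d`. It is a supremum in `[0, ∞]`, so that no value is assigned by default. -/
def matrixOpNorm {d : ℕ} (N : Seminorm ℂ (Fin d → ℂ)) (A : Matrix (Fin d) (Fin d) ℂ) : ℝ≥0∞ :=
  ⨆ (v : Fin d → ℂ) (_ : N v = 1), ENNReal.ofReal (N (A *ᵥ v))

/-- `‖Σ‖ = sup_{A ∈ Σ} ‖A‖`. -/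
def setNorm {d : ℕ} (N : Seminorm ℂ (Fin d → ℂ)) (S : Set (Matrix (Fin d) (Fin d) ℂ)) : ℝ≥0∞ :=
  ⨆ A ∈ S, matrixOpNorm N A

/-- `ρ(Σ) = sup_{A ∈ Σ} ρ(A)`. -/
def setSpectralRadius {d : ℕ} (S : Set (Matrix (Fin d) (Fin d) ℂ)) : ℝ≥0∞ :=
  ⨆ A ∈ S, spectralRadius ℂ A

/-- The joint spectral radius `R(Σ) = lim_{n → ∞} ‖Σ^n‖^{1/n}`, where `Σ^n` is the set of all
products `A₁ ⋯ Aₙ` with `Aᵢ ∈ Σ`, computed with the norm `N`. -/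
def jointSpectralRadius {d : ℕ} (N : Seminorm ℂ (Fin d → ℂ))
    (S : Set (Matrix (Fin d) (Fin d) ℂ)) : ℝ≥0∞ :=
  limUnder atTop (fun n : ℕ => setNorm N (S ^ n) ^ (1 / (n : ℝ)))

/-- Boundedness of a set of matrices (in any norm, equivalently entrywise). -/
def IsBoundedMatrixSet {d : ℕ} (S : Set (Matrix (Fin d) (Fin d) ℂ)) : Prop :=
  ∃ C : ℝ, ∀ A ∈ S, ∀ i j, ‖A i j‖ ≤ C

end

/-!
Suppose that the spectral radius of every product of `n` elements of `S` is at most `r ^ n` for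
large `n`. Then the trace of such a product `x` acting by left multiplication on the algebra `B`
generated by `S` is `O(r ^ n)`, and so are the numbers `tr (b * x)` for `b` in a finite set of
products of elements of `S` spanning `B`. In characteristic zero the trace form
`(y, x) ↦ tr (y * x)` has its radical inside the Jacobson radical `J` of `B`, so `x` is congruent
modulo `J` to an element of norm `O(r ^ n)`. As `J` is nilpotent, it does not affect exponential
growth rates: along the filtration `B ⊇ J ⊇ J ^ 2 ⊇ ⋯` multiplication by `x` is triangular with
diagonal part `O(r ^ n)`. Hence `‖S ^ n‖ = O(r' ^ n)` for every `r' > r`. The opposite inequality is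
`ρ(a) ^ n ≤ ρ(a ^ n) ≤ ‖a ^ n‖`.
-/

section Trace

open Polynomial in
theorem exists_isIdempotentElem_mul {K B : Type*} [Field K] [Ring B] [Algebra K B] {x : B}
    (hx : IsIntegral K x) :
    ∃ (y : B) (m : ℕ), IsIdempotentElem (y * x) ∧ x ^ m * (y * x) = x ^ m := by
  obtain ⟨q, hq, hdvd⟩ :=
    (minpoly K x).exists_eq_pow_rootMultiplicity_mul_and_not_dvd (minpoly.ne_zero hx) 0
  set m := (minpoly K x).rootMultiplicity 0
  rw [C_0, sub_zero] at hq hdvd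
  obtain ⟨a, b, hab⟩ : IsCoprime (X ^ (m + 1) : K[X]) q :=
    (irreducible_X.coprime_iff_not_dvd.2 hdvd).pow_left
  have hzero : aeval x (X ^ m * q) = 0 := hq ▸ minpoly.aeval K x
  have hyx : aeval x (a * X ^ m) * x = aeval x (a * X ^ (m + 1)) := by
    simp only [map_mul, map_pow, aeval_X, pow_succ, mul_assoc]
  -- Fitting decomposition: `y * x` projects onto the range of `x ^ m` along its kernel.
  refine ⟨aeval x (a * X ^ m), m, ?_, ?_⟩
  · have hpoly : a * X ^ (m + 1) * (a * X ^ (m + 1)) =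
        a * X ^ (m + 1) - a * X * b * (X ^ m * q) := by
      linear_combination a * X ^ (m + 1) * hab
    rw [IsIdempotentElem, hyx, ← map_mul, hpoly, map_sub, map_mul _ _ (X ^ m * q), hzero,
      mul_zero, sub_zero]
  · have hpoly : X ^ m * (a * X ^ (m + 1)) = X ^ m - b * (X ^ m * q) := by
      linear_combination X ^ m * hab
    have hXm : aeval x (X ^ m : K[X]) = x ^ m := by rw [map_pow, aeval_X]
    rw [hyx, ← hXm, ← map_mul, hpoly, map_sub, map_mul _ b, hzero, mul_zero, sub_zero]

theorem mem_ringJacobson_of_forall_isNilpotent_mul {R : Type*} [Ring R] {x : R}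
    (h : ∀ y, IsNilpotent (y * x)) : x ∈ Ring.jacobson R := by
  rw [← Ideal.jacobson_bot, Ideal.mem_jacobson_iff]
  intro y
  obtain ⟨u, hu⟩ := (h y).isUnit_add_one
  refine ⟨↑u⁻¹, ?_⟩
  have hinv : (↑u⁻¹ : R) * (y * x + 1) = 1 := hu ▸ u.inv_mul
  rw [Ideal.mem_bot, mul_assoc, ← mul_add_one, hinv, sub_self]

variable (K B : Type*) [Field K] [Ring B] [Algebra K B]

/-- The trace of left multiplication on the algebra `B`. Mathlib's `Algebra.trace` is restricted
to commutative algebras. -/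
noncomputable def regularTrace : B →ₗ[K] K :=
  LinearMap.trace K B ∘ₗ (Algebra.lmul K B).toLinearMap

variable {K B} [FiniteDimensional K B]

theorem eq_zero_of_isIdempotentElem_of_regularTrace_eq_zero [CharZero K] {e : B}
    (he : IsIdempotentElem e) (h : regularTrace K B e = 0) : e = 0 :=
  Algebra.lmul_injective (R := K) <|
    (LinearMap.IsIdempotentElem.eq_zero_of_trace_eq_zero (he.map (Algebra.lmul K B)) h).trans
      (map_zero _).symm

theorem mem_ringJacobson_of_regularTrace_mul_eq_zero [CharZero K] {x : B}
    (h : ∀ y, regularTrace K B (y * x) = 0) : x ∈ Ring.jacobson B := by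
  refine mem_ringJacobson_of_forall_isNilpotent_mul fun y => ?_
  obtain ⟨z, m, hidem, hpow⟩ :=
    exists_isIdempotentElem_mul (Algebra.IsIntegral.isIntegral (R := K) (y * x))
  have hzero : z * (y * x) = 0 :=
    eq_zero_of_isIdempotentElem_of_regularTrace_eq_zero hidem (mul_assoc z y x ▸ h (z * y))
  exact ⟨m, by rw [← hpow, hzero, mul_zero]⟩

end Trace

theorem norm_trace_le_of_spectrum {K V : Type*} [NormedField K] [IsAlgClosed K] [AddCommGroup V]
    [Module K V] [FiniteDimensional K V] (f : Module.End K V) {r : ℝ}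
    (h : ∀ z ∈ spectrum K f, ‖z‖ ≤ r) : ‖LinearMap.trace K V f‖ ≤ Module.finrank K V * r := by
  rw [Module.End.trace_eq_sum_roots_charpoly_of_splits (IsAlgClosed.splits _)]
  have hcard : f.charpoly.roots.card = Module.finrank K V := by
    rw [IsAlgClosed.card_roots_eq_natDegree, LinearMap.charpoly_natDegree]
  have hroot : ∀ t ∈ f.charpoly.roots.map (‖·‖), t ≤ r :=
    Multiset.forall_mem_map_iff.2 fun z hz =>
      h z ((Module.End.mem_spectrum_iff_isRoot_charpoly f z).2 (Polynomial.isRoot_of_mem_roots hz))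
  calc ‖f.charpoly.roots.sum‖ ≤ (f.charpoly.roots.map (‖·‖)).sum := norm_multiset_sum_le _
    _ ≤ (f.charpoly.roots.map (‖·‖)).card • r := Multiset.sum_le_card_nsmul _ r hroot
    _ = Module.finrank K V * r := by rw [Multiset.card_map, hcard, nsmul_eq_mul]

theorem norm_regularTrace_le_of_spectrum {K B : Type*} [NormedField K] [IsAlgClosed K] [Ring B]
    [Algebra K B] [FiniteDimensional K B] {x : B} {r : ℝ} (h : ∀ z ∈ spectrum K x, ‖z‖ ≤ r) :
    ‖regularTrace K B x‖ ≤ Module.finrank K B * r :=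
  norm_trace_le_of_spectrum _ fun z hz => h z (AlgHom.spectrum_apply_subset (Algebra.lmul K B) x hz)

theorem spectrum_subset_of_injective {R B A : Type*} [CommRing R] [Ring B] [Algebra R B]
    [IsArtinianRing B] [Ring A] [Algebra R A] {f : B →ₐ[R] A} (hf : Function.Injective f) (x : B) :
    spectrum R x ⊆ spectrum R (f x) := by
  refine fun z hz hunit => hz (IsArtinianRing.isUnit_iff_isRightRegular.2 fun a b hab => hf ?_)
  have hmap : f (algebraMap R B z - x) = algebraMap R A z - f x := by
    rw [map_sub, AlgHom.commutes]
  refine hunit.mul_right_cancel ?_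
  rw [← hmap, ← map_mul, ← map_mul]
  exact congrArg f hab

section Growth

variable {B : Type*} [NormedRing B]

/-- The products of `n` elements of `S` have norm `O(r ^ n)`, uniformly in the factors. -/
def HasGrowthBound (S : Set B) (r : ℝ) : Prop :=
  ∃ D : ℝ, 0 ≤ D ∧ ∀ n : ℕ, ∀ x ∈ S ^ n, ‖x‖ ≤ D * r ^ n

variable {S : Set B} {r r' : ℝ}

theorem hasGrowthBound_of_norm_le (hr : 0 ≤ r) (hS : ∀ x ∈ S, ‖x‖ ≤ r) : HasGrowthBound S r := by
  refine ⟨‖(1 : B)‖, norm_nonneg _, fun n => ?_⟩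
  induction n with
  | zero => simp
  | succ n ih =>
    intro x hx
    rw [pow_succ] at hx
    obtain ⟨w, hw, z, hz, rfl⟩ := Set.mem_mul.1 hx
    calc ‖w * z‖ ≤ ‖w‖ * ‖z‖ := norm_mul_le w z
      _ ≤ ‖(1 : B)‖ * r ^ n * r :=
        mul_le_mul (ih w hw) (hS z hz) (norm_nonneg z) (by positivity)
      _ = ‖(1 : B)‖ * r ^ (n + 1) := by ring

theorem isBounded_set_pow (hS : Bornology.IsBounded S) (n : ℕ) : Bornology.IsBounded (S ^ n) := by
  obtain ⟨M, hM, hSM⟩ := hS.exists_pos_norm_le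
  obtain ⟨D, -, hD⟩ := hasGrowthBound_of_norm_le hM.le hSM
  exact isBounded_iff_forall_norm_le.2 ⟨_, hD n⟩

theorem eventually_const_mul_pow_le_pow (C : ℝ) (hr : 0 ≤ r) (hrr' : r < r') :
    ∀ᶠ n : ℕ in atTop, C * r ^ n ≤ r' ^ n := by
  filter_upwards [((isLittleO_pow_pow_of_lt_left hr hrr').const_mul_left C).bound one_pos] with n hn
  rw [one_mul, Real.norm_of_nonneg (pow_nonneg (hr.trans hrr'.le) n)] at hn
  exact (le_abs_self _).trans hn

theorem HasGrowthBound.eventually_norm_le (hS : HasGrowthBound S r) (hr : 0 ≤ r) (hrr' : r < r') :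
    ∀ᶠ n : ℕ in atTop, ∀ x ∈ S ^ n, ‖x‖ ≤ r' ^ n := by
  obtain ⟨D, -, hD⟩ := hS
  filter_upwards [eventually_const_mul_pow_le_pow D hr hrr'] with n hn x hx
  exact (hD n x hx).trans hn

theorem HasGrowthBound.of_pow (hS : Bornology.IsBounded S) (hr : 0 < r) {n : ℕ} (hn : 0 < n)
    (h : HasGrowthBound (S ^ n) (r ^ n)) : HasGrowthBound S r := by
  obtain ⟨D, hD, hDm⟩ := h
  obtain ⟨M, hM, hSM⟩ := hS.exists_pos_norm_le
  obtain ⟨E, hE, hEm⟩ := hasGrowthBound_of_norm_le hM.le hSM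
  set Q := ∑ i ∈ Finset.range n, E * (M / r) ^ i
  have hshort : ∀ i < n, ∀ z ∈ S ^ i, ‖z‖ ≤ Q * r ^ i := by
    intro i hi z hz
    calc ‖z‖ ≤ E * M ^ i := hEm i z hz
      _ = E * (M / r) ^ i * r ^ i := by rw [mul_assoc, ← mul_pow, div_mul_cancel₀ M hr.ne']
      _ ≤ Q * r ^ i := by
        gcongr
        exact Finset.single_le_sum (f := fun j => E * (M / r) ^ j) (fun j _ => by positivity)
          (Finset.mem_range.2 hi)
  refine ⟨D * Q, by positivity, fun N x hx => ?_⟩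
  rw [← Nat.div_add_mod N n, pow_add, pow_mul] at hx
  obtain ⟨w, hw, z, hz, rfl⟩ := Set.mem_mul.1 hx
  calc ‖w * z‖ ≤ ‖w‖ * ‖z‖ := norm_mul_le w z
    _ ≤ D * (r ^ n) ^ (N / n) * (Q * r ^ (N % n)) :=
      mul_le_mul (hDm _ w hw) (hshort _ (Nat.mod_lt N hn) z hz) (norm_nonneg z) (by positivity)
    _ = D * Q * ((r ^ n) ^ (N / n) * r ^ (N % n)) := by ring
    _ = D * Q * r ^ N := by rw [← pow_mul, ← pow_add, Nat.div_add_mod]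

theorem exists_norm_mul_le_of_mul_mem {T I I' : Set B} {α β r D' : ℝ} (hβ : 0 ≤ β) (hαr : α < r)
    (hD' : 0 ≤ D')
    (hT : ∀ z ∈ T, ∃ s, ‖s‖ ≤ α ∧ ‖z - s‖ ≤ β ∧ ∀ a ∈ I, a * s ∈ I ∧ a * (z - s) ∈ I')
    (hI' : ∀ m : ℕ, ∀ a ∈ I', ∀ w ∈ T ^ m, ‖a * w‖ ≤ D' * r ^ m * ‖a‖) :
    ∃ D, 0 ≤ D ∧ ∀ m : ℕ, ∀ a ∈ I, ∀ w ∈ T ^ m, ‖a * w‖ ≤ D * r ^ m * ‖a‖ := by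
  have hgap : 0 < r - α := sub_pos.2 hαr
  obtain ⟨D, hD, hone, hrec⟩ : ∃ D, 0 ≤ D ∧ 1 ≤ D ∧ D * α + D' * β ≤ D * r := by
    refine ⟨1 + D' * β / (r - α), by positivity, le_add_of_nonneg_right (by positivity), ?_⟩
    have hcancel : D' * β / (r - α) * (r - α) = D' * β := div_mul_cancel₀ _ hgap.ne'
    linarith
  refine ⟨D, hD, fun m => ?_⟩
  induction m with
  | zero =>
    rintro a - w hw
    obtain rfl : w = 1 := by simpa using hw
    simpa using le_mul_of_one_le_left (norm_nonneg a) hone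
  | succ m ih =>
    intro a ha w hw
    rw [pow_succ'] at hw
    obtain ⟨z, hz, v, hv, rfl⟩ := Set.mem_mul.1 hw
    obtain ⟨s, hsα, hsβ, hmem⟩ := hT z hz
    obtain ⟨has, haz⟩ := hmem a ha
    have hr : 0 ≤ r := (norm_nonneg s).trans (hsα.trans hαr.le)
    calc ‖a * (z * v)‖ = ‖a * s * v + a * (z - s) * v‖ := by congr 1; noncomm_ring
      _ ≤ ‖a * s * v‖ + ‖a * (z - s) * v‖ := norm_add_le _ _
      _ ≤ D * r ^ m * ‖a * s‖ + D' * r ^ m * ‖a * (z - s)‖ :=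
        add_le_add (ih _ has v hv) (hI' m _ haz v hv)
      _ ≤ D * r ^ m * (‖a‖ * α) + D' * r ^ m * (‖a‖ * β) := by
        gcongr <;> exact norm_mul_le_of_le le_rfl ‹_›
      _ = (D * α + D' * β) * (r ^ m * ‖a‖) := by ring
      _ ≤ D * r * (r ^ m * ‖a‖) := by gcongr
      _ = D * r ^ (m + 1) * ‖a‖ := by ring

theorem HasGrowthBound.of_sub_mem_isNilpotent {J : Ideal B} [J.IsTwoSided] (hJ : IsNilpotent J)
    {T : Set B} (hTb : Bornology.IsBounded T) {α r : ℝ} (hαr : α < r)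
    (hT : ∀ z ∈ T, ∃ s, ‖s‖ ≤ α ∧ z - s ∈ J) : HasGrowthBound T r := by
  obtain ⟨k, hk⟩ := hJ
  obtain ⟨M, hM, hTM⟩ := hTb.exists_pos_norm_le
  have hlevel : ∃ D, 0 ≤ D ∧ ∀ m : ℕ, ∀ a ∈ J ^ 0, ∀ w ∈ T ^ m, ‖a * w‖ ≤ D * r ^ m * ‖a‖ := by
    refine Nat.decreasingInduction (n := k) (motive := fun i _ => ∃ D, 0 ≤ D ∧
      ∀ m : ℕ, ∀ a ∈ J ^ i, ∀ w ∈ T ^ m, ‖a * w‖ ≤ D * r ^ m * ‖a‖) ?_ ?_ k.zero_le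
    · rintro i - ⟨D', hD', hbound⟩
      refine exists_norm_mul_le_of_mul_mem (I := ((J ^ i : Ideal B) : Set B))
        (I' := ((J ^ (i + 1) : Ideal B) : Set B)) (α := α) (β := M + |α|)
        (by positivity) hαr hD' (fun z hz => ?_) hbound
      obtain ⟨s, hsα, hzs⟩ := hT z hz
      refine ⟨s, hsα, norm_sub_le_of_le (hTM z hz) (hsα.trans (le_abs_self α)), fun a ha =>
        ⟨Ideal.mul_mem_right s _ ha, ?_⟩⟩
      rw [SetLike.mem_coe, Submodule.pow_succ]
      exact Ideal.mul_mem_mul ha hzs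
    · refine ⟨0, le_rfl, fun m a ha w _ => ?_⟩
      obtain rfl : a = 0 := by simpa [hk] using ha
      simp
  obtain ⟨D, hD, hbound⟩ := hlevel
  refine ⟨D * ‖(1 : B)‖, by positivity, fun m w hw => ?_⟩
  have hone : (1 : B) ∈ J ^ 0 := by rw [Submodule.pow_zero, Ideal.one_eq_top]; trivial
  simpa only [one_mul, mul_right_comm] using hbound m 1 hone w hw

end Growth

section RegularTraceGrowth

variable {𝕜 : Type*} [NontriviallyNormedField 𝕜] [CompleteSpace 𝕜]

theorem exists_map_eq_norm_le {E F : Type*} [NormedAddCommGroup E] [NormedSpace 𝕜 E]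
    [FiniteDimensional 𝕜 E] [NormedAddCommGroup F] [NormedSpace 𝕜 F] (f : E →ₗ[𝕜] F) :
    ∃ C > 0, ∀ x, ∃ s, f s = f x ∧ ‖s‖ ≤ C * ‖f x‖ := by
  have : CompleteSpace E := FiniteDimensional.complete 𝕜 E
  have : CompleteSpace (LinearMap.range f) := FiniteDimensional.complete 𝕜 _
  obtain ⟨C, hC, hpre⟩ := (LinearMap.toContinuousLinearMap f.rangeRestrict).exists_preimage_norm_le
    f.surjective_rangeRestrict
  refine ⟨C, hC, fun x => ?_⟩
  obtain ⟨s, hs, hsC⟩ := hpre (f.rangeRestrict x)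
  exact ⟨s, congrArg Subtype.val hs, hsC⟩

theorem exists_mem_pow_of_mem_closure {M : Type*} [Monoid M] {S : Set M} {x : M}
    (hx : x ∈ Submonoid.closure S) : ∃ n : ℕ, x ∈ S ^ n := by
  induction hx using Submonoid.closure_induction with
  | mem x hx => exact ⟨1, by rwa [pow_one]⟩
  | one => exact ⟨0, by rw [pow_zero]; exact Set.one_mem_one⟩
  | mul x y _ _ ihx ihy =>
    obtain ⟨m, hm⟩ := ihx
    obtain ⟨n, hn⟩ := ihy
    exact ⟨m + n, pow_add S m n ▸ Set.mul_mem_mul hm hn⟩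

theorem eventually_forall_norm_apply_mul_le {B : Type*} [Monoid B] {E : Type*} [Norm E]
    {S : Set B} {τ : B → E} {c r : ℝ}
    (hτ : ∀ᶠ n : ℕ in atTop, ∀ x ∈ S ^ n, ‖τ x‖ ≤ c * r ^ n) {b : B}
    (hb : b ∈ Submonoid.closure S) :
    ∃ c', ∀ᶠ n : ℕ in atTop, ∀ x ∈ S ^ n, ‖τ (b * x)‖ ≤ c' * r ^ n := by
  obtain ⟨k, hk⟩ := exists_mem_pow_of_mem_closure hb
  refine ⟨c * r ^ k, ?_⟩
  filter_upwards [(tendsto_add_atTop_nat k).eventually hτ] with n hn x hx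
  calc ‖τ (b * x)‖ ≤ c * r ^ (n + k) :=
        hn _ (add_comm k n ▸ pow_add S k n ▸ Set.mul_mem_mul hk hx)
    _ = c * r ^ k * r ^ n := by ring

variable {B : Type*} [NormedRing B] [NormedAlgebra 𝕜 B] [FiniteDimensional 𝕜 B] {S : Set B}

theorem exists_norm_le_apply_mul_sub_eq_zero {τ : B →ₗ[𝕜] 𝕜} {c r : ℝ} (hr : 0 < r)
    (hspan : Submodule.span 𝕜 (Submonoid.closure S : Set B) = ⊤)
    (hτ : ∀ᶠ n : ℕ in atTop, ∀ x ∈ S ^ n, ‖τ x‖ ≤ c * r ^ n) :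
    ∃ C, ∀ᶠ n : ℕ in atTop, ∀ x ∈ S ^ n, ∃ s, ‖s‖ ≤ C * r ^ n ∧ ∀ y, τ (y * (x - s)) = 0 := by
  obtain ⟨b, hb, hbspan, -⟩ :=
    Submodule.exists_fun_fin_finrank_span_eq 𝕜 (Submonoid.closure S : Set B)
  choose c' hc' using fun i => eventually_forall_norm_apply_mul_le hτ (hb i)
  let pairing : B →ₗ[𝕜] _ → 𝕜 := LinearMap.pi fun i => τ ∘ₗ LinearMap.mulLeft 𝕜 (b i)
  obtain ⟨C, hC, hpre⟩ := exists_map_eq_norm_le pairing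
  refine ⟨C * ∑ i, |c' i|, ?_⟩
  filter_upwards [eventually_all.2 hc'] with n hn x hx
  obtain ⟨s, hs, hsC⟩ := hpre x
  refine ⟨s, hsC.trans ?_, fun y => ?_⟩
  · rw [mul_assoc, Finset.sum_mul]
    gcongr
    refine (pi_norm_le_iff_of_nonneg (by positivity)).2 fun i => ?_
    calc ‖τ (b i * x)‖ ≤ c' i * r ^ n := hn i x hx
      _ ≤ |c' i| * r ^ n := by gcongr; exact le_abs_self _
      _ ≤ ∑ j, |c' j| * r ^ n :=
        Finset.single_le_sum (f := fun j => |c' j| * r ^ n) (fun j _ => by positivity)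
          (Finset.mem_univ i)
  · have hle : Submodule.span 𝕜 (Set.range b) ≤
        LinearMap.ker (τ ∘ₗ LinearMap.mulRight 𝕜 (x - s)) := by
      rw [Submodule.span_le, Set.range_subset_iff]
      intro i
      have hi : τ (b i * s) = τ (b i * x) := congrFun hs i
      simp only [SetLike.mem_coe, LinearMap.mem_ker, LinearMap.comp_apply,
        LinearMap.mulRight_apply, mul_sub, map_sub, hi, sub_self]
    exact hle (hbspan.trans hspan ▸ Submodule.mem_top : y ∈ _)

theorem HasGrowthBound.of_regularTrace [CharZero 𝕜] (hS : Bornology.IsBounded S) {c r r' : ℝ}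
    (hr : 0 < r) (hrr' : r < r')
    (hspan : Submodule.span 𝕜 (Submonoid.closure S : Set B) = ⊤)
    (htrace : ∀ᶠ n : ℕ in atTop, ∀ x ∈ S ^ n, ‖regularTrace 𝕜 B x‖ ≤ c * r ^ n) :
    HasGrowthBound S r' := by
  have : IsArtinianRing B := IsArtinianRing.of_finite 𝕜 B
  obtain ⟨t, hrt, htr'⟩ := exists_between hrr'
  have ht : 0 < t := hr.trans hrt
  obtain ⟨C, hC⟩ := exists_norm_le_apply_mul_sub_eq_zero hr hspan htrace
  obtain ⟨n, hn, hsplit, hCt⟩ := ((eventually_gt_atTop 0).and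
    (hC.and (eventually_const_mul_pow_le_pow C hr.le hrt))).exists
  refine .of_pow hS (ht.trans htr') hn <| .of_sub_mem_isNilpotent
    (J := Ring.jacobson B) IsSemiprimaryRing.isNilpotent
    (isBounded_set_pow hS n) (pow_lt_pow_left₀ htr' ht.le hn.ne') fun x hx => ?_
  obtain ⟨s, hs, hker⟩ := hsplit x hx
  exact ⟨s, hs.trans hCt, mem_ringJacobson_of_regularTrace_mul_eq_zero hker⟩

end RegularTraceGrowth

theorem HasGrowthBound.of_spectrum {𝕜 A : Type*} [NontriviallyNormedField 𝕜] [CompleteSpace 𝕜]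
    [IsAlgClosed 𝕜] [CharZero 𝕜] [NormedRing A] [NormedAlgebra 𝕜 A] [FiniteDimensional 𝕜 A]
    {S : Set A} (hS : Bornology.IsBounded S) {r r' : ℝ} (hr : 0 < r) (hrr' : r < r')
    (hspec : ∀ᶠ n : ℕ in atTop, ∀ x ∈ S ^ n, ∀ z ∈ spectrum 𝕜 x, ‖z‖ ≤ r ^ n) :
    HasGrowthBound S r' := by
  let B := Algebra.adjoin 𝕜 S
  let S' : Set B := Subtype.val ⁻¹' S
  have himage (n : ℕ) : B.val '' (S' ^ n) = S ^ n := by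
    rw [Set.image_pow]
    congr 1
    exact (Subtype.image_preimage_coe _ S).trans (Set.inter_eq_right.2 Algebra.subset_adjoin)
  have hbounded : Bornology.IsBounded S' := by
    obtain ⟨M, hM⟩ := hS.exists_norm_le
    exact isBounded_iff_forall_norm_le.2 ⟨M, fun x hx => hM x hx⟩
  have hspan : Submodule.span 𝕜 (Submonoid.closure S' : Set B) = ⊤ := by
    rw [← Algebra.adjoin_eq_span, Algebra.adjoin_adjoin_coe_preimage, Algebra.top_toSubmodule]
  have : IsArtinianRing B := IsArtinianRing.of_finite 𝕜 B
  obtain ⟨D, hD, hbound⟩ : HasGrowthBound S' r' := by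
    refine .of_regularTrace (𝕜 := 𝕜) hbounded hr hrr' hspan (c := Module.finrank 𝕜 B) ?_
    filter_upwards [hspec] with n hn x hx
    exact norm_regularTrace_le_of_spectrum fun z hz =>
      hn x (himage n ▸ Set.mem_image_of_mem B.val hx) z
        (spectrum_subset_of_injective (f := B.val) Subtype.val_injective x hz)
  refine ⟨D, hD, fun n x hx => ?_⟩
  obtain ⟨y, hy, rfl⟩ := (himage n).symm ▸ hx
  exact hbound n y hy

section JointSpectralRadius

theorem eventually_le_pow_of_limsup_rpow_lt {u : ℕ → ℝ≥0∞} {b : ℝ≥0∞}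
    (h : limsup (fun n : ℕ => u n ^ (1 / (n : ℝ))) atTop < b) : ∀ᶠ n in atTop, u n ≤ b ^ n := by
  filter_upwards [eventually_lt_of_limsup_lt h, eventually_gt_atTop 0] with n hn hn0
  rw [← ENNReal.rpow_natCast, ← ENNReal.rpow_inv_le_iff (Nat.cast_pos.2 hn0), ← one_div]
  exact hn.le

theorem limsup_rpow_le_of_eventually_le_pow {u : ℕ → ℝ≥0∞} {b : ℝ≥0∞}
    (h : ∀ᶠ n in atTop, u n ≤ b ^ n) : limsup (fun n : ℕ => u n ^ (1 / (n : ℝ))) atTop ≤ b := by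
  refine limsup_le_of_le (h := ?_)
  filter_upwards [h, eventually_gt_atTop 0] with n hn hn0
  rwa [one_div, ENNReal.rpow_inv_le_iff (Nat.cast_pos.2 hn0), ENNReal.rpow_natCast]

theorem spectralRadius_le_enorm {𝕜 A : Type*} [NormedField 𝕜] [NormedRing A] [NormedAlgebra 𝕜 A]
    [CompleteSpace A] (a : A) : spectralRadius 𝕜 a ≤ ‖a‖ₑ := by
  refine (spectrum.spectralRadius_le_liminf_pow_nnnorm_pow_one_div 𝕜 a).trans ?_
  refine (liminf_le_limsup).trans (limsup_rpow_le_of_eventually_le_pow ?_)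
  filter_upwards [eventually_gt_atTop 0] with n hn
  rw [enorm_eq_nnnorm]
  exact_mod_cast nnnorm_pow_le' a hn

/-- The supremum of the norms of the elements of `S`, in `[0, ∞]` so that it is meaningful for
every set. -/
noncomputable def supNorm {A : Type*} [NormedRing A] (S : Set A) : ℝ≥0∞ := ⨆ x ∈ S, ‖x‖ₑ

/-- The supremum of the spectral radii over `𝕜` of the elements of `S`. -/
noncomputable def supSpectralRadius (𝕜 : Type*) {A : Type*} [NormedField 𝕜] [Ring A] [Algebra 𝕜 A]
    (S : Set A) : ℝ≥0∞ := ⨆ x ∈ S, spectralRadius 𝕜 x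

/-- The joint spectral radius `lim ‖S ^ n‖ ^ (1 / n)` of a set in an arbitrary normed ring. -/
noncomputable def normedJointSpectralRadius {A : Type*} [NormedRing A] (S : Set A) : ℝ≥0∞ :=
  limUnder atTop fun n : ℕ => supNorm (S ^ n) ^ (1 / (n : ℝ))

section NormedRing

variable {A : Type*} [NormedRing A] {S : Set A}

theorem supNorm_lt_top (hS : Bornology.IsBounded S) : supNorm S < ⊤ := by
  obtain ⟨M, hM⟩ := hS.exists_norm_le
  refine (iSup₂_le fun x hx => ?_).trans_lt (ENNReal.ofReal_lt_top (r := M))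
  rw [← ofReal_norm]
  exact ENNReal.ofReal_le_ofReal (hM x hx)

theorem supNorm_pow_le (S : Set A) {n : ℕ} (hn : 0 < n) : supNorm (S ^ n) ≤ supNorm S ^ n := by
  induction n, hn using Nat.le_induction with
  | base => rw [pow_one, pow_one]
  | succ n _ ih =>
    refine iSup₂_le fun x hx => ?_
    rw [pow_succ] at hx
    obtain ⟨y, hy, z, hz, rfl⟩ := Set.mem_mul.1 hx
    have hmul : ‖y * z‖ₑ ≤ ‖y‖ₑ * ‖z‖ₑ := by
      rw [enorm_eq_nnnorm, enorm_eq_nnnorm, enorm_eq_nnnorm]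
      exact_mod_cast nnnorm_mul_le y z
    calc ‖y * z‖ₑ ≤ ‖y‖ₑ * ‖z‖ₑ := hmul
      _ ≤ supNorm S ^ n * supNorm S :=
        mul_le_mul' ((le_iSup₂ (f := fun x _ => ‖x‖ₑ) y hy).trans ih)
          (le_iSup₂ (f := fun x _ => ‖x‖ₑ) z hz)
      _ = supNorm S ^ (n + 1) := (pow_succ _ n).symm

theorem supSpectralRadius_rpow_le_supNorm_rpow {𝕜 : Type*} [NormedField 𝕜] [NormedAlgebra 𝕜 A]
    [CompleteSpace A] (S : Set A) {k n : ℕ} (hk : 0 < k) (hn : 0 < n) :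
    supSpectralRadius 𝕜 (S ^ k) ^ (1 / (k : ℝ)) ≤ supNorm (S ^ n) ^ (1 / (n : ℝ)) := by
  have hk' : (0 : ℝ) < k := Nat.cast_pos.2 hk
  have hn' : (0 : ℝ) < n := Nat.cast_pos.2 hn
  rw [one_div, ENNReal.rpow_inv_le_iff hk', ← ENNReal.rpow_mul, one_div_mul_eq_div, div_eq_mul_inv,
    ENNReal.rpow_mul]
  refine iSup₂_le fun x hx => ?_
  rw [ENNReal.le_rpow_inv_iff hn', ENNReal.rpow_natCast, ENNReal.rpow_natCast]
  have hmem : x ^ n ∈ (S ^ n) ^ k := by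
    rw [← pow_mul, mul_comm, pow_mul]
    exact Set.pow_mem_pow hx
  calc spectralRadius 𝕜 x ^ n ≤ spectralRadius 𝕜 (x ^ n) :=
        spectrum.spectralRadius_pow_le x n hn.ne'
    _ ≤ ‖x ^ n‖ₑ := spectralRadius_le_enorm (x ^ n)
    _ ≤ supNorm ((S ^ n) ^ k) := le_iSup₂ (f := fun x _ => ‖x‖ₑ) _ hmem
    _ ≤ supNorm (S ^ n) ^ k := supNorm_pow_le _ hk

end NormedRing

variable {𝕜 A : Type*} [NontriviallyNormedField 𝕜] [CompleteSpace 𝕜] [IsAlgClosed 𝕜] [CharZero 𝕜]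
  [NormedRing A] [NormedAlgebra 𝕜 A] [FiniteDimensional 𝕜 A] {S : Set A}

theorem limsup_supNorm_rpow_le (hS : Bornology.IsBounded S) :
    limsup (fun n : ℕ => supNorm (S ^ n) ^ (1 / (n : ℝ))) atTop ≤
      limsup (fun n : ℕ => supSpectralRadius 𝕜 (S ^ n) ^ (1 / (n : ℝ))) atTop := by
  refine le_of_forall_gt_imp_ge_of_dense fun b hb => ?_
  obtain ⟨t, ht, htb⟩ := ENNReal.lt_iff_exists_nnreal_btwn.1 hb
  obtain ⟨q, hq, hqt⟩ := ENNReal.lt_iff_exists_nnreal_btwn.1 ht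
  obtain ⟨p, hp, hpq⟩ := ENNReal.lt_iff_exists_nnreal_btwn.1 hq
  have hp0 : 0 < p := ENNReal.coe_pos.1 (pos_of_gt hp)
  have hgrowth : HasGrowthBound S q := by
    refine .of_spectrum (𝕜 := 𝕜) hS (NNReal.coe_pos.2 hp0) (by exact_mod_cast hpq) ?_
    filter_upwards [eventually_le_pow_of_limsup_rpow_lt hp] with n hn x hx z hz
    have hz' : (‖z‖₊ : ℝ≥0∞) ≤ p ^ n :=
      (le_iSup₂ (f := fun z _ => (‖z‖₊ : ℝ≥0∞)) z hz).trans
        ((le_iSup₂ (f := fun x _ => spectralRadius 𝕜 x) x hx).trans hn)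
    exact_mod_cast hz'
  refine (limsup_rpow_le_of_eventually_le_pow ?_).trans htb.le
  filter_upwards [hgrowth.eventually_norm_le q.2 (by exact_mod_cast hqt)] with n hn
  exact iSup₂_le fun x hx => by exact_mod_cast hn x hx

theorem mainTheorem3_general (hS : Bornology.IsBounded S) :
    Tendsto (fun n : ℕ => supNorm (S ^ n) ^ (1 / (n : ℝ))) atTop
        (𝓝 (normedJointSpectralRadius S)) ∧
      normedJointSpectralRadius S < ⊤ ∧
      normedJointSpectralRadius S =
        limsup (fun n : ℕ => supSpectralRadius 𝕜 (S ^ n) ^ (1 / (n : ℝ))) atTop := by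
  have : CompleteSpace A := FiniteDimensional.complete 𝕜 A
  have hlower {n : ℕ} (hn : 0 < n) :
      limsup (fun k : ℕ => supSpectralRadius 𝕜 (S ^ k) ^ (1 / (k : ℝ))) atTop ≤
        supNorm (S ^ n) ^ (1 / (n : ℝ)) :=
    limsup_le_of_le (h := (eventually_gt_atTop 0).mono fun _ hk =>
      supSpectralRadius_rpow_le_supNorm_rpow S hk hn)
  have hlim := tendsto_of_le_liminf_of_limsup_le
    (le_liminf_of_le (h := (eventually_gt_atTop 0).mono fun _ => hlower))
    (limsup_supNorm_rpow_le (𝕜 := 𝕜) hS)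
  have heq : normedJointSpectralRadius S = _ := hlim.limUnder_eq
  refine ⟨heq ▸ hlim, ?_, heq⟩
  calc normedJointSpectralRadius S ≤ supNorm (S ^ 1) ^ (1 / ((1 : ℕ) : ℝ)) := heq ▸ hlower one_pos
    _ = supNorm S := by rw [pow_one, Nat.cast_one, one_div_one, ENNReal.rpow_one]
    _ < ⊤ := supNorm_lt_top hS

end JointSpectralRadius

section MatrixNorm

/-- A copy of the vector space `E` that carries the norm `N`, so that a norm given as a definite
seminorm can be used through the type class `NormedSpace`. -/
def NormedCopy {𝕜 E : Type*} [NormedField 𝕜] [AddCommGroup E] [Module 𝕜 E] (N : Seminorm 𝕜 E)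
    (_hN : ∀ v, N v = 0 → v = 0) : Type _ := E

namespace NormedCopy

variable {𝕜 E : Type*} [NormedField 𝕜] [AddCommGroup E] [Module 𝕜 E] (N : Seminorm 𝕜 E)
  (hN : ∀ v, N v = 0 → v = 0)

instance : AddCommGroup (NormedCopy N hN) := inferInstanceAs (AddCommGroup E)

instance : Module 𝕜 (NormedCopy N hN) := inferInstanceAs (Module 𝕜 E)

instance : Norm (NormedCopy N hN) := ⟨fun v : E => N v⟩

theorem core : NormedSpace.Core 𝕜 (NormedCopy N hN) where
  norm_nonneg := apply_nonneg N
  norm_smul := map_smul_eq_mul N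
  norm_triangle := map_add_le_add N
  norm_eq_zero_iff v := ⟨hN v, fun hv => hv ▸ map_zero N⟩

instance : NormedAddCommGroup (NormedCopy N hN) := .ofCore (core N hN)

instance : NormedSpace 𝕜 (NormedCopy N hN) := .ofCore (core N hN)

instance [FiniteDimensional 𝕜 E] : FiniteDimensional 𝕜 (NormedCopy N hN) :=
  inferInstanceAs (FiniteDimensional 𝕜 E)

/-- The identity map from `E` to its normed copy. -/
def equiv : E ≃ₗ[𝕜] NormedCopy N hN := LinearEquiv.refl 𝕜 E

end NormedCopy

variable {d : ℕ} (N : Seminorm ℂ (Fin d → ℂ)) (hN : ∀ v, N v = 0 → v = 0)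

/-- A matrix, as a continuous operator on `ℂ^d` normed by `N`. -/
noncomputable def matrixOperator : Matrix (Fin d) (Fin d) ℂ ≃ₐ[ℂ]
    (NormedCopy N hN →L[ℂ] NormedCopy N hN) :=
  (Matrix.toLinAlgEquiv'.trans ((NormedCopy.equiv N hN).conjAlgEquiv ℂ)).trans
    (Module.End.toContinuousLinearMap (NormedCopy N hN))

theorem norm_matrixOperator_apply_equiv (A : Matrix (Fin d) (Fin d) ℂ) (v : Fin d → ℂ) :
    ‖matrixOperator N hN A (NormedCopy.equiv N hN v)‖ = N (A *ᵥ v) := rfl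

theorem matrixOpNorm_eq_enorm (A : Matrix (Fin d) (Fin d) ℂ) :
    matrixOpNorm N A = ‖matrixOperator N hN A‖ₑ := by
  rw [← ofReal_norm]
  refine le_antisymm (iSup₂_le fun v hv => ENNReal.ofReal_le_ofReal ?_) ?_
  · rw [← norm_matrixOperator_apply_equiv N hN]
    exact (matrixOperator N hN A).unit_le_opNorm (NormedCopy.equiv N hN v) hv.le
  · rcases eq_or_ne (matrixOpNorm N A) ⊤ with htop | hfinite
    · exact htop ▸ le_top
    · refine ENNReal.ofReal_le_of_le_toReal
        (ContinuousLinearMap.opNorm_le_of_unit_norm ENNReal.toReal_nonneg fun v hv => ?_)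
      obtain ⟨v, rfl⟩ := (NormedCopy.equiv N hN).surjective v
      rw [norm_matrixOperator_apply_equiv]
      exact (ENNReal.ofReal_le_iff_le_toReal hfinite).1
        (le_iSup₂ (f := fun v (_ : N v = 1) => ENNReal.ofReal (N (A *ᵥ v))) v hv)

theorem setNorm_pow_eq_supNorm (S : Set (Matrix (Fin d) (Fin d) ℂ)) (n : ℕ) :
    setNorm N (S ^ n) = supNorm ((matrixOperator N hN '' S) ^ n) := by
  rw [← Set.image_pow, supNorm, iSup_image, setNorm]
  simp only [matrixOpNorm_eq_enorm N hN]

theorem setSpectralRadius_pow_eq_supSpectralRadius (S : Set (Matrix (Fin d) (Fin d) ℂ)) (n : ℕ) :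
    setSpectralRadius (S ^ n) = supSpectralRadius ℂ ((matrixOperator N hN '' S) ^ n) := by
  rw [← Set.image_pow, supSpectralRadius, iSup_image, setSpectralRadius]
  simp only [spectralRadius, AlgEquiv.spectrum_eq]

theorem IsBoundedMatrixSet.isBounded_image {S : Set (Matrix (Fin d) (Fin d) ℂ)}
    (hS : IsBoundedMatrixSet S) : Bornology.IsBounded (matrixOperator N hN '' S) := by
  obtain ⟨C, hC⟩ := hS
  refine isBounded_iff_forall_norm_le.2
    ⟨∑ i, ∑ j, C * ‖matrixOperator N hN (Matrix.single i j 1)‖, Set.forall_mem_image.2 ?_⟩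
  intro A hA
  have hsum : matrixOperator N hN A =
      ∑ i, ∑ j, A i j • matrixOperator N hN (Matrix.single i j 1) := by
    conv_lhs => rw [Matrix.matrix_eq_sum_single A]
    simp only [map_sum, ← map_smul, Matrix.smul_single, smul_eq_mul, mul_one]
  rw [hsum]
  refine norm_sum_le_of_le _ fun i _ => norm_sum_le_of_le _ fun j _ => ?_
  rw [norm_smul]
  gcongr
  exact hC A hA i j

end MatrixNorm

theorem mainTheorem3 (d : ℕ) (hd : 1 ≤ d)
    (N : Seminorm ℂ (Fin d → ℂ)) (hN : ∀ v : Fin d → ℂ, N v = 0 → v = 0)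
    (S : Set (Matrix (Fin d) (Fin d) ℂ)) (hne : S.Nonempty) (hS : IsBoundedMatrixSet S) :
    Tendsto (fun n : ℕ => setNorm N (S ^ n) ^ (1 / (n : ℝ))) atTop
        (𝓝 (jointSpectralRadius N S)) ∧
      jointSpectralRadius N S < ⊤ ∧
      jointSpectralRadius N S =
        limsup (fun n : ℕ => setSpectralRadius (S ^ n) ^ (1 / (n : ℝ))) atTop := by
  simpa only [jointSpectralRadius, normedJointSpectralRadius,
    setNorm_pow_eq_supNorm N hN, setSpectralRadius_pow_eq_supSpectralRadius N hN] using
    mainTheorem3_general (𝕜 := ℂ) (hS.isBounded_image N hN)
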